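/- Setting. Consider $n=m+k$ agents with positions $p_i=x_i+y_i\iota\in\mathbb C$ and dynamics $\dot p_i=v_i$; agents $1,\dots,m$ are leaders ($\mathcal V_L$) and agents $m+1,\dots,n$ are followers ($\mathcal V_F$). A nominal formation $(\mathcal G,r)$ consists of a directed graph $\mathcal G$ with edge set $\mathcal E$ on the agents, constant nominal positions $r_1,\dots,r_n\in\mathbb C$, and for every follower $i$ two distinct constraint neighbours $j,k$ with $(i,j),(i,k)\in\mathcal E$. Put $$w_{ij}=\frac{\overline{r_j-r_i}}{|r_j-r_i|^2},\qquad w_{ik}=-\frac{\overline{r_k-r_i}}{|r_k-r_i|^2},$$ and $w_{il}=0$ for every other agent $l$. Let $W_f\in\mathbb C^{(n-m)\times n}$ be the matrix with $[W_f]_{ii}=w_{ij}+w_{ik}$ and $[W_f]_{il}=-w_{il}$ for $l\ne i$ ($i\in\mathcal V_F$), and write $W_f=[\,W_{fl}\ \ W_{ff}\,]$ with $W_{fl}\in\mathbb C^{(n-m)\times m}$ and $W_{ff}\in\mathbb C^{(n-m)\times(n-m)}$. The nominal formation is localizable if $W_{ff}$ is invertible. Protocols. Let $p_1^*,\dots,p_m^*:[0,\infty)\to\mathbb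 C$, $p_i^*=x_i^*+y_i^*\iota$, be differentiable target trajectories of the leaders. The leaders use $$v_i=-\tanh(x_i-x_i^*)-\iota\tanh(y_i-y_i^*)+\dot p_i^*,\qquad i\in\mathcal V_L .$$ Let $\digamma(z)=z/|z|$ for $z\neq0$ and $\digamma(0)=0$. With a real gain $\alpha_2$, the followers use the relative-position protocol $$v_i=u_i+\alpha_2\,\digamma(u_i),\qquad u_i=\gamma_{ijk}+\sum_{g}\gamma_{gil},\qquad i\in\mathcal V_F,$$ where $j,k$ are the two constraint neighbours of $i$, the sum runs over the followers $g$ having $i$ as one of their two constraint neighbours, $l$ being the other one, and $$\gamma_{ijk}=\overline{(w_{ij}+w_{ik})}\,\bigl[w_{ij}(p_j-p_i)+w_{ik}(p_k-p_i)\bigr],\qquad \gamma_{gil}=\overline{w_{gi}}\,w_{gi}(p_g-p_i)+\overline{w_{gi}}\,w_{gl}(p_g-p_l).$$ Solutions of the resulting closed-loop system $\dot p=f(p,t)$, $p\in\mathbb C^n$, are understood in the sense of Filippov: $p:[0,\infty)\to\mathbb C^n$ is absolutely continuous on every $[0,T]$ and $\dot p(t)\in\bigcap_{\varphi>0}\bigcap_{\mu(N)=0}\overline{\mathrm{co}}\,f(B(p(t),\varphi)\setminus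 N,\,t)$ for almost every $t\ge0$, where $\mu$ is Lebesgue measure. Theorem. Assume that (i) $|\dot p_i^*(t)|\le\delta$ for every leader $i$ and every $t\ge0$; (ii) the nominal formation is localizable, and for each follower $i$ with constraint neighbours $j,k$ the points $r_i,r_j,r_k$ are pairwise distinct; (iii) the subgraph of $\mathcal G$ among the followers is undirected, i.e. for followers $i,g$, $(i,g)\in\mathcal E$ implies $(g,i)\in\mathcal E$; (iv) $\alpha_2\ge\xi(\sqrt2+\delta)\,m$, where $\xi$ is the largest modulus of an entry of $W_{ff}^{-1}W_{fl}$ ($\xi=0$ if there is no entry). Then along every Filippov solution $p$ of the closed-loop system on $[0,\infty)$, the follower error tends to zero: $$\lim_{t\to\infty}\bigl(p_F(t)+W_{ff}^{-1}W_{fl}\,p_L(t)\bigr)=0,$$ where $p_L$ and $p_F$ are the vectors of leader and follower positions. -/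

import Mathlib

open Set Filter Topology MeasureTheory

noncomputable section

namespace Formation

/-! ### Filippov solutions -/

/-- Filippov's set-valued regularisation
`K[f](q, t) = ⋂_{φ > 0} ⋂_{μ N = 0} closedConvexHull (f (B(q, φ) \ N), t)` of a (discontinuous)
time-varying vector field `f`, where `μ` is Lebesgue measure. (The intersection over all radii does
not depend on which of the equivalent norms defines the balls.) -/
def filippovMap {E : Type*} [NormedAddCommGroup E] [NormedSpace ℝ E] [MeasureSpace E]
    (f : ℝ → E → E) (t : ℝ) (q : E) : Set E :=
  ⋂ (φ : ℝ) (_ : 0 < φ) (N : Set E) (_ : volume N = 0),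
    closedConvexHull ℝ (f t '' (Metric.ball q φ \ N))

/-- `q` is a Filippov solution of `q' = f(q, t)` on `[t₀, t₁]`: it is absolutely continuous there and
`q'(t) ∈ K[f](q(t), t)` for almost all `t ∈ [t₀, t₁]`. -/
def IsFilippovSolutionOn {E : Type*} [NormedAddCommGroup E] [NormedSpace ℝ E] [MeasureSpace E]
    (f : ℝ → E → E) (q : ℝ → E) (t₀ t₁ : ℝ) : Prop :=
  AbsolutelyContinuousOnInterval q t₀ t₁ ∧
    ∀ᵐ t ∂(volume.restrict (Icc t₀ t₁)), ∃ v ∈ filippovMap f t (q t), HasDerivAt q v t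

/-! ### Nominal formations and the complex Laplacian -/

/-- The `n = m + k` agents: `m` leaders (`Sum.inl`) and `k` followers (`Sum.inr`). -/
abbrev Agent (m k : ℕ) := Fin m ⊕ Fin k

/-- A nominal formation `(G, r)` in the complex plane. An edge `G.Adj i j` means that agent `i` can
obtain information from agent `j`. Every follower `i` has two neighbours `nbr₁ i`, `nbr₂ i` in `G`
with which it forms its complex constraint. -/
structure Nominal (m k : ℕ) where
  /-- the communication graph -/
  G : Digraph (Agent m k)
  /-- the nominal configuration -/
  r : Agent m k → ℂ
  /-- the first constraint neighbour of each follower -/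
  nbr₁ : Fin k → Agent m k
  /-- the second constraint neighbour of each follower -/
  nbr₂ : Fin k → Agent m k
  adj_nbr₁ : ∀ i, G.Adj (Sum.inr i) (nbr₁ i)
  adj_nbr₂ : ∀ i, G.Adj (Sum.inr i) (nbr₂ i)
  nbr₁_ne_nbr₂ : ∀ i, nbr₁ i ≠ nbr₂ i

namespace Nominal

variable {m k : ℕ} (F : Nominal m k)

/-- The complex weights: `w_ij = (r_j - r_i)^H / d_ij²` and `w_ik = -(r_k - r_i)^H / d_ik²` for the
two constraint neighbours `j`, `k` of follower `i`; no other agent enters its constraint. -/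
def w (i : Fin k) (l : Agent m k) : ℂ :=
  if l = F.nbr₁ i then
    (starRingEnd ℂ) (F.r l - F.r (Sum.inr i)) / ((‖F.r l - F.r (Sum.inr i)‖ : ℝ) : ℂ) ^ 2
  else if l = F.nbr₂ i then
    -((starRingEnd ℂ) (F.r l - F.r (Sum.inr i)) / ((‖F.r l - F.r (Sum.inr i)‖ : ℝ) : ℂ) ^ 2)
  else 0

/-- The matrix `W_f` of the complex constraints: row sums of the weights on the diagonal, minus the
weights elsewhere. -/
def Wf : Matrix (Fin k) (Agent m k) ℂ :=
  Matrix.of fun i l =>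
    if l = Sum.inr i then F.w i (F.nbr₁ i) + F.w i (F.nbr₂ i) else -F.w i l

/-- The leader block `W_fl` of `W_f = [W_fl  W_ff]`. -/
def Wfl : Matrix (Fin k) (Fin m) ℂ := F.Wf.toCols₁

/-- The follower block `W_ff` of `W_f = [W_fl  W_ff]`. -/
def Wff : Matrix (Fin k) (Fin k) ℂ := F.Wf.toCols₂

/-- The nominal formation is localizable: `W_ff` is invertible. -/
def Localizable : Prop := IsUnit F.Wff

/-- Each follower and its two constraint neighbours occupy three distinct nominal positions. -/
def NonCollocated : Prop :=
  ∀ i : Fin k, F.r (Sum.inr i) ≠ F.r (F.nbr₁ i) ∧ F.r (Sum.inr i) ≠ F.r (F.nbr₂ i) ∧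
    F.r (F.nbr₁ i) ≠ F.r (F.nbr₂ i)

/-- The subgraph among the followers is undirected. -/
def FollowersUndirected : Prop :=
  ∀ i g : Fin k, F.G.Adj (Sum.inr i) (Sum.inr g) → F.G.Adj (Sum.inr g) (Sum.inr i)

/-- `ξ`, the largest modulus of an entry of `W_ff⁻¹ W_fl`. -/
def xi : ℝ := ⨆ ij : Fin k × Fin m, ‖(F.Wff⁻¹ * F.Wfl) ij.1 ij.2‖

/-- The follower tracking error `e_F = p_F + W_ff⁻¹ W_fl p_L`. -/
def followerError (p : Agent m k → ℂ) : Fin k → ℂ :=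
  (fun i => p (Sum.inr i)) + (F.Wff⁻¹ * F.Wfl).mulVec (fun j => p (Sum.inl j))

end Nominal

/-! ### The control protocols -/

/-- The normalisation `z ↦ z / ‖z‖`, with value `0` at `0`. -/
def normalise (z : ℂ) : ℂ := if z = 0 then 0 else z / ((‖z‖ : ℝ) : ℂ)

/-- The velocity `dp_j*/dt` of a target trajectory on `[0, ∞)` (one-sided at `0`). -/
def targetVel (pstar : ℝ → ℂ) (t : ℝ) : ℂ := derivWithin pstar (Ici 0) t

/-- The leader protocol
`v = -tanh (x - x*) - ι tanh (y - y*) + dp*/dt` at position `z = x + ι y`. -/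
def leaderControl (pstar : ℝ → ℂ) (t : ℝ) (z : ℂ) : ℂ :=
  -((Real.tanh (z.re - (pstar t).re) : ℝ) : ℂ)
    - Complex.I * ((Real.tanh (z.im - (pstar t).im) : ℝ) : ℂ) + targetVel pstar t

namespace Nominal

variable {m k : ℕ} (F : Nominal m k)

/-- `γ_ijk = (w_ij + w_ik)^H [w_ij (p_j - p_i) + w_ik (p_k - p_i)]`, where `j`, `k` are the two
constraint neighbours of follower `i`. -/
def gammaOwn (p : Agent m k → ℂ) (i : Fin k) : ℂ :=
  (starRingEnd ℂ) (F.w i (F.nbr₁ i) + F.w i (F.nbr₂ i)) *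
    (F.w i (F.nbr₁ i) * (p (F.nbr₁ i) - p (Sum.inr i)) +
      F.w i (F.nbr₂ i) * (p (F.nbr₂ i) - p (Sum.inr i)))

/-- `γ_gil = w_gi^H w_gi (p_g - p_i) + w_gi^H w_gl (p_g - p_l)`, where `i`, `l` are the two
constraint neighbours of follower `g`. -/
def gammaNbr (p : Agent m k → ℂ) (g i : Fin k) (l : Agent m k) : ℂ :=
  (starRingEnd ℂ) (F.w g (Sum.inr i)) * F.w g (Sum.inr i) * (p (Sum.inr g) - p (Sum.inr i)) +
    (starRingEnd ℂ) (F.w g (Sum.inr i)) * F.w g l * (p (Sum.inr g) - p l)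

/-- `γ_ijk + ∑ γ_gil`, the sum running over the followers `g` that have follower `i` as one of their
two constraint neighbours, the other one being `l`. -/
def drive (p : Agent m k → ℂ) (i : Fin k) : ℂ :=
  F.gammaOwn p i + ∑ g : Fin k,
    if F.nbr₁ g = Sum.inr i then F.gammaNbr p g i (F.nbr₂ g)
    else if F.nbr₂ g = Sum.inr i then F.gammaNbr p g i (F.nbr₁ g)
    else 0

/-- The follower protocol with gain `α₂`, using relative positions only. -/
def followerControl (α₂ : ℝ) (p : Agent m k → ℂ) (i : Fin k) : ℂ :=
  F.drive p i + (α₂ : ℂ) * normalise (F.drive p i)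

/-- The closed-loop vector field of all agents, `dp_i/dt = v_i`: the leaders track their targets
`pstar` and the followers use the relative-position protocol. -/
def closedLoop (α₂ : ℝ) (pstar : Fin m → ℝ → ℂ) (t : ℝ) (p : Agent m k → ℂ) : Agent m k → ℂ :=
  Sum.elim (fun j => leaderControl (pstar j) t (p (Sum.inl j))) (fun i => F.followerControl α₂ p i)

end Nominal

end Formation

end

/-!
Write `z = W_f p` for the vector of constraint violations and `A = W_ff⁻¹ W_fl`. Then
`z = W_ff e_F`, where `e_F = p_F + A p_L` is the follower error (`Wff_mulVec_followerError`), and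
the follower drive is the negative gradient `u = -W_ffᴴ z` (`drive_eq_neg_conjTranspose_mulVec`).
The Lyapunov function is `V = ∑ i, ‖z i‖²`, whose derivative along a velocity `v` is
`-2 Re ∑ i, conj (u i) * (v_F + A v_L) i`.

For a velocity `v` in the Filippov set at `q` this is at most `-2 ∑ i, ‖u i‖²`
(`sum_sq_norm_drive_le_of_mem_filippovMap`): the unit-vector feedback contributes `α₂ ∑ i, ‖u i‖`,
which dominates the leader disturbance since every entry of `A v_L` is at most `α₂` in modulus. The
discontinuity of the feedback is harmless here, because a Filippov velocity obeys every linear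
inequality that the values of the field near `q` obey up to a continuous error
(`le_of_mem_filippovMap`), and `Re (conj z * w / ‖w‖) ≥ ‖w‖ - ‖z - w‖` is such an inequality.

As `W_ff` is invertible, `V ≤ C ∑ i, ‖u i‖²`, hence `V' ≤ -(2 / C) V` almost everywhere; as `V` is
absolutely continuous, it decays exponentially (`le_exp_mul_of_ae_deriv_le`).
-/

namespace Formation

/-! ### Absolutely continuous functions -/

theorem _root_.AbsolutelyContinuousOnInterval.lipschitz_comp {X Y : Type*} [PseudoMetricSpace X]
    [PseudoMetricSpace Y] {f : ℝ → X} {g : X → Y} {K : NNReal} {a b : ℝ}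
    (hf : AbsolutelyContinuousOnInterval f a b) (hg : LipschitzWith K g) :
    AbsolutelyContinuousOnInterval (fun t => g (f t)) a b := by
  refine squeeze_zero (fun E => Finset.sum_nonneg fun i _ => dist_nonneg) (fun E => ?_)
    (by simpa using Tendsto.const_mul (K : ℝ) hf)
  rw [Finset.mul_sum]
  exact Finset.sum_le_sum fun i _ => hg.dist_le_mul _ _

theorem _root_.AbsolutelyContinuousOnInterval.finset_sum {ι E : Type*} [SeminormedAddCommGroup E]
    {f : ι → ℝ → E} {a b : ℝ} (s : Finset ι)
    (hf : ∀ i ∈ s, AbsolutelyContinuousOnInterval (f i) a b) :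
    AbsolutelyContinuousOnInterval (fun t => ∑ i ∈ s, f i t) a b := by
  classical
  induction s using Finset.induction_on with
  | empty =>
    simpa using (LipschitzWith.const (0 : E)).lipschitzOnWith.absolutelyContinuousOnInterval
  | insert i s hi ih =>
    simp only [Finset.sum_insert hi]
    exact (hf i (by simp)).fun_add (ih fun j hj => hf j (by simp [hj]))

/-- Grönwall's inequality for an absolutely continuous function whose differential inequality
holds almost everywhere. -/
theorem le_exp_mul_of_ae_deriv_le {V : ℝ → ℝ} {c T : ℝ} (hT : 0 ≤ T)
    (hV : AbsolutelyContinuousOnInterval V 0 T)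
    (hder : ∀ᵐ t ∂(volume.restrict (Icc 0 T)), ∃ V', HasDerivAt V V' t ∧ V' ≤ -c * V t) :
    V T ≤ Real.exp (-c * T) * V 0 := by
  have hexp : AbsolutelyContinuousOnInterval (fun t => Real.exp (c * t)) 0 T :=
    ContDiffOn.absolutelyContinuousOnInterval (by fun_prop)
  have hint := (hexp.fun_mul hV).integral_deriv_eq_sub
  have hle : ∫ t in (0 : ℝ)..T, deriv (fun t => Real.exp (c * t) * V t) t ≤ 0 := by
    rw [intervalIntegral.integral_of_le hT, ← integral_Icc_eq_integral_Ioc]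
    refine integral_nonpos_of_ae ?_
    filter_upwards [hder] with t ⟨V', hV', hle⟩
    have h1 : HasDerivAt (fun t => Real.exp (c * t)) (Real.exp (c * t) * c) t := by
      simpa using ((hasDerivAt_id t).const_mul c).exp
    rw [(h1.fun_mul hV').deriv]
    have : Real.exp (c * t) * (c * V t + V') ≤ 0 :=
      mul_nonpos_of_nonneg_of_nonpos (Real.exp_pos _).le (by linarith)
    simp only [Pi.zero_apply]
    linarith
  rw [hint] at hle
  simp only [mul_zero, Real.exp_zero, one_mul] at hle
  have h2 : Real.exp (-c * T) * Real.exp (c * T) = 1 := by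
    rw [← Real.exp_add]; simp
  calc V T = Real.exp (-c * T) * (Real.exp (c * T) * V T) := by rw [← mul_assoc, h2, one_mul]
    _ ≤ Real.exp (-c * T) * V 0 := by gcongr; linarith

/-! ### Linear inequalities for Filippov velocities -/

/-- If a continuous functional `ℓ` is bounded below along the field `f t` by a function continuous
at `q`, then its value at `q` bounds `ℓ` below on the Filippov set at `q`. -/
theorem le_of_mem_filippovMap {E : Type*} [NormedAddCommGroup E] [NormedSpace ℝ E] [MeasureSpace E]
    {f : ℝ → E → E} {t : ℝ} {q v : E} (hv : v ∈ filippovMap f t q) (ℓ : E →L[ℝ] ℝ) {g : E → ℝ}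
    (hg : ContinuousAt g q) (hle : ∀ x, g x ≤ ℓ (f t x)) : g q ≤ ℓ v := by
  refine le_of_forall_pos_sub_le fun ε hε => ?_
  obtain ⟨φ, hφ, hball⟩ := Metric.continuousAt_iff.1 hg ε hε
  have hmem : v ∈ closedConvexHull ℝ (f t '' (Metric.ball q φ \ ∅)) := by
    simp only [filippovMap, mem_iInter] at hv
    exact hv φ hφ ∅ measure_empty
  have hsub : closedConvexHull ℝ (f t '' (Metric.ball q φ \ ∅)) ⊆ {x | g q - ε ≤ ℓ x} := by
    refine closedConvexHull_min ?_ (convex_halfSpace_ge ℓ.toLinearMap.isLinear _)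
      (isClosed_le continuous_const ℓ.continuous)
    rintro _ ⟨x, hx, rfl⟩
    have h := abs_lt.1 (hball hx.1)
    have := hle x
    simp only [mem_ofPred_eq]
    linarith [h.1]
  exact hsub hmem

/-! ### Bounds on controls and matrices -/

theorem norm_leaderControl_le {pstar : ℝ → ℂ} {t δ : ℝ} (h : ‖targetVel pstar t‖ ≤ δ) (z : ℂ) :
    ‖leaderControl pstar t z‖ ≤ √2 + δ := by
  refine (norm_add_le _ _).trans (add_le_add ?_ h)
  set a := Real.tanh (z.re - (pstar t).re) with ha
  set b := Real.tanh (z.im - (pstar t).im) with hb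
  have ha1 : |a| < 1 := Real.abs_tanh_lt_one _
  have hb1 : |b| < 1 := Real.abs_tanh_lt_one _
  refine (Complex.norm_le_sqrt_two_mul_max _).trans ?_
  have : max |(-(a : ℂ) - Complex.I * b).re| |(-(a : ℂ) - Complex.I * b).im| ≤ 1 := by
    simpa using ⟨ha1.le, hb1.le⟩
  simpa using mul_le_mul_of_nonneg_left this (Real.sqrt_nonneg 2)

theorem norm_sub_norm_sub_le_re_conj_mul_normalise (z w : ℂ) :
    ‖w‖ - ‖z - w‖ ≤ ((starRingEnd ℂ) z * normalise w).re := by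
  unfold normalise
  split_ifs with hw
  · simp [hw]
  have hw' : (0 : ℝ) < ‖w‖ := norm_pos_iff.2 hw
  have hsplit : (starRingEnd ℂ) z * (w / ((‖w‖ : ℝ) : ℂ))
      = ((‖w‖ : ℝ) : ℂ) + (starRingEnd ℂ) (z - w) * (w / ((‖w‖ : ℝ) : ℂ)) := by
    have h0 : ((‖w‖ : ℝ) : ℂ) ≠ 0 := by exact_mod_cast hw'.ne'
    have h1 : (starRingEnd ℂ) w * w = ((‖w‖ : ℝ) : ℂ) ^ 2 := Complex.conj_mul' w
    rw [map_sub]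
    field_simp
    linear_combination h1
  have hnorm : ‖(starRingEnd ℂ) (z - w) * (w / ((‖w‖ : ℝ) : ℂ))‖ = ‖z - w‖ := by
    rw [norm_mul, RCLike.norm_conj, norm_div, Complex.norm_real, norm_norm, div_self hw'.ne',
      mul_one]
  rw [hsplit, Complex.add_re, Complex.ofReal_re]
  have := (abs_le.1 (Complex.abs_re_le_norm
    ((starRingEnd ℂ) (z - w) * (w / ((‖w‖ : ℝ) : ℂ))))).1
  linarith

/-- A matrix is bounded for the Euclidean norm. -/
theorem exists_sum_sq_norm_mulVec_le {ι κ : Type*} [Fintype ι] [Fintype κ] (B : Matrix ι κ ℂ) :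
    ∃ C : ℝ, 0 < C ∧ ∀ x : κ → ℂ, ∑ i, ‖B.mulVec x i‖ ^ 2 ≤ C * ∑ j, ‖x j‖ ^ 2 := by
  refine ⟨∑ i, ∑ j, ‖B i j‖ ^ 2 + 1, by positivity, fun x => ?_⟩
  have h : ∀ i, ‖B.mulVec x i‖ ^ 2 ≤ (∑ j, ‖B i j‖ ^ 2) * ∑ j, ‖x j‖ ^ 2 := fun i =>
    calc ‖B.mulVec x i‖ ^ 2 ≤ (∑ j, ‖B i j‖ * ‖x j‖) ^ 2 := by
          gcongr
          refine (norm_sum_le _ _).trans_eq ?_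
          simp
      _ ≤ _ := Finset.sum_mul_sq_le_sq_mul_sq _ _ _
  calc ∑ i, ‖B.mulVec x i‖ ^ 2 ≤ ∑ i, (∑ j, ‖B i j‖ ^ 2) * ∑ j, ‖x j‖ ^ 2 :=
        Finset.sum_le_sum fun i _ => h i
    _ = (∑ i, ∑ j, ‖B i j‖ ^ 2) * ∑ j, ‖x j‖ ^ 2 := by rw [Finset.sum_mul]
    _ ≤ _ := by gcongr; linarith

namespace Nominal

variable {m k : ℕ} (F : Nominal m k)

/-! ### The drive as a gradient -/

theorem nbr₁_ne_self (hcol : F.NonCollocated) (i : Fin k) : F.nbr₁ i ≠ Sum.inr i :=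
  fun h => (hcol i).1 (by rw [h])

theorem nbr₂_ne_self (hcol : F.NonCollocated) (i : Fin k) : F.nbr₂ i ≠ Sum.inr i :=
  fun h => (hcol i).2.1 (by rw [h])

theorem w_eq_zero {i : Fin k} {l : Agent m k} (h₁ : l ≠ F.nbr₁ i) (h₂ : l ≠ F.nbr₂ i) :
    F.w i l = 0 := by
  simp [w, h₁, h₂]

/-- The violation of the complex constraint of follower `i`. -/
theorem Wf_mulVec_apply (hcol : F.NonCollocated) (p : Agent m k → ℂ) (i : Fin k) :
    F.Wf.mulVec p i = F.w i (F.nbr₁ i) * (p (Sum.inr i) - p (F.nbr₁ i))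
      + F.w i (F.nbr₂ i) * (p (Sum.inr i) - p (F.nbr₂ i)) := by
  have h₁ := F.nbr₁_ne_self hcol i
  have h₂ := F.nbr₂_ne_self hcol i
  have h₁₂ := F.nbr₁_ne_nbr₂ i
  have hterm : ∀ l, F.Wf i l * p l
      = (if l = Sum.inr i then (F.w i (F.nbr₁ i) + F.w i (F.nbr₂ i)) * p l else 0)
        - (if l = F.nbr₁ i then F.w i l * p l else 0)
        - (if l = F.nbr₂ i then F.w i l * p l else 0) := by
    intro l
    simp only [Wf, Matrix.of_apply]
    by_cases ha : l = Sum.inr i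
    · subst ha
      simp [h₁.symm, h₂.symm]
    · by_cases hb : l = F.nbr₁ i
      · subst hb
        simp [h₁, h₁₂]
      · by_cases hc : l = F.nbr₂ i
        · subst hc
          simp [h₂, h₁₂.symm]
        · simp [ha, hb, hc, F.w_eq_zero hb hc]
  rw [Matrix.mulVec, dotProduct, Finset.sum_congr rfl fun l _ => hterm l]
  simp only [Finset.sum_sub_distrib, Finset.sum_ite_eq', Finset.mem_univ, if_true]
  ring

theorem Wff_apply (g i : Fin k) :
    F.Wff g i = if i = g then F.w g (F.nbr₁ g) + F.w g (F.nbr₂ g) else -F.w g (Sum.inr i) := by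
  simp [Wff, Wf]

theorem drive_eq_neg_conjTranspose_mulVec (hcol : F.NonCollocated) (p : Agent m k → ℂ) :
    F.drive p = -(F.Wff.conjTranspose.mulVec (F.Wf.mulVec p)) := by
  funext i
  have hterm : ∀ g, (starRingEnd ℂ) (F.Wff g i) * F.Wf.mulVec p g
      = (if g = i then -F.gammaOwn p i else 0)
        - (if F.nbr₁ g = Sum.inr i then F.gammaNbr p g i (F.nbr₂ g)
            else if F.nbr₂ g = Sum.inr i then F.gammaNbr p g i (F.nbr₁ g) else 0) := by
    intro g
    rw [F.Wf_mulVec_apply hcol, Wff_apply]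
    by_cases hgi : g = i
    · subst hgi
      simp only [if_true, F.nbr₁_ne_self hcol, F.nbr₂_ne_self hcol, if_false, gammaOwn]
      ring
    · rw [if_neg (Ne.symm hgi), if_neg hgi]
      by_cases hb : F.nbr₁ g = Sum.inr i
      · rw [if_pos hb, gammaNbr, hb, map_neg]
        ring
      · by_cases hc : F.nbr₂ g = Sum.inr i
        · rw [if_neg hb, if_pos hc, gammaNbr, hc, map_neg]
          ring
        · rw [if_neg hb, if_neg hc, F.w_eq_zero (Ne.symm hb) (Ne.symm hc)]
          simp
  have hsum : F.Wff.conjTranspose.mulVec (F.Wf.mulVec p) i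
      = ∑ g, (starRingEnd ℂ) (F.Wff g i) * F.Wf.mulVec p g := rfl
  rw [Pi.neg_apply, hsum, Finset.sum_congr rfl fun g _ => hterm g]
  simp only [Finset.sum_sub_distrib, Finset.sum_ite_eq', Finset.mem_univ, if_true, drive]
  ring

theorem Wff_mulVec_followerError (hloc : F.Localizable) (p : Agent m k → ℂ) :
    F.Wff.mulVec (F.followerError p) = F.Wf.mulVec p := by
  have hdet : IsUnit F.Wff.det := (Matrix.isUnit_iff_isUnit_det _).1 hloc
  have hsplit : F.Wf.mulVec p
      = F.Wfl.mulVec (p ∘ Sum.inl) + F.Wff.mulVec (p ∘ Sum.inr) := by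
    rw [← Matrix.fromCols_mulVec, Wfl, Wff, Matrix.fromCols_toCols]
  rw [hsplit, followerError, Matrix.mulVec_add, Matrix.mulVec_mulVec,
    Matrix.mul_nonsing_inv_cancel_left _ _ hdet, add_comm]
  rfl

/-! ### The Lyapunov inequality -/

/-- The derivative of `½ ∑ i, ‖(W_f p) i‖²` in the direction `v`, in terms of the drive. -/
theorem sum_conj_Wf_mul_eq (hloc : F.Localizable) (hcol : F.NonCollocated)
    (q v : Agent m k → ℂ) :
    ∑ i, (starRingEnd ℂ) (F.Wf.mulVec q i) * F.Wf.mulVec v i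
      = -∑ i, (starRingEnd ℂ) (F.drive q i) * F.followerError v i := by
  have h : star (F.Wf.mulVec q) ⬝ᵥ F.Wff.mulVec (F.followerError v)
      = -(star (F.drive q) ⬝ᵥ F.followerError v) := by
    rw [F.drive_eq_neg_conjTranspose_mulVec hcol, Matrix.dotProduct_mulVec, star_neg,
      Matrix.star_mulVec F.Wff.conjTranspose, Matrix.conjTranspose_conjTranspose, neg_dotProduct,
      neg_neg]
  rw [F.Wff_mulVec_followerError hloc] at h
  exact h

theorem norm_le_xi (i : Fin k) (j : Fin m) : ‖(F.Wff⁻¹ * F.Wfl) i j‖ ≤ F.xi :=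
  le_ciSup (f := fun ij : Fin k × Fin m => ‖(F.Wff⁻¹ * F.Wfl) ij.1 ij.2‖)
    (Set.finite_range _).bddAbove (i, j)

/-- The leader velocities disturb each follower error by at most the gain. -/
theorem norm_mulVec_le_gain {ρ α₂ : ℝ} (hα : F.xi * ρ * m ≤ α₂) {x : Fin m → ℂ}
    (hx : ∀ j, ‖x j‖ ≤ ρ) (i : Fin k) : ‖(F.Wff⁻¹ * F.Wfl).mulVec x i‖ ≤ α₂ := by
  refine le_trans ?_ hα
  calc ‖(F.Wff⁻¹ * F.Wfl).mulVec x i‖ ≤ ∑ j, ‖(F.Wff⁻¹ * F.Wfl) i j * x j‖ :=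
        norm_sum_le Finset.univ fun j => (F.Wff⁻¹ * F.Wfl) i j * x j
    _ ≤ ∑ _j : Fin m, F.xi * ρ := by
        refine Finset.sum_le_sum fun j _ => ?_
        rw [norm_mul]
        exact mul_le_mul (F.norm_le_xi i j) (hx j) (norm_nonneg _)
          ((norm_nonneg _).trans (F.norm_le_xi i j))
    _ = F.xi * ρ * m := by simp [mul_comm]

theorem continuous_drive (hcol : F.NonCollocated) : Continuous F.drive := by
  have : F.drive = fun p => -(F.Wff.conjTranspose.mulVec (F.Wf.mulVec p)) :=
    funext (F.drive_eq_neg_conjTranspose_mulVec hcol)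
  rw [this]
  fun_prop

/-- The functional `v ↦ Re ∑ i, conj (a i) * (v_F + W_ff⁻¹ W_fl v_L) i`. -/
noncomputable def errorFunctional (a : Fin k → ℂ) : (Agent m k → ℂ) →L[ℝ] ℝ :=
  LinearMap.toContinuousLinearMap
    { toFun := fun v => (∑ i, (starRingEnd ℂ) (a i) * F.followerError v i).re
      map_add' := fun v v' => by
        have : F.followerError (v + v') = F.followerError v + F.followerError v' := by
          have h : (fun j => (v + v') (Sum.inl j))
              = (fun j => v (Sum.inl j)) + fun j => v' (Sum.inl j) := rfl
          simp only [followerError]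
          rw [h, Matrix.mulVec_add]
          funext i
          simp only [Pi.add_apply]
          ring
        simp [this, mul_add, Finset.sum_add_distrib]
      map_smul' := fun c v => by
        have : F.followerError (c • v) = c • F.followerError v := by
          have h : (fun j => (c • v) (Sum.inl j)) = c • fun j => v (Sum.inl j) := rfl
          simp only [followerError]
          rw [h, Matrix.mulVec_smul, smul_add]
          rfl
        simp [this, mul_left_comm _ (c : ℂ), ← Finset.mul_sum] }

theorem errorFunctional_apply (a : Fin k → ℂ) (v : Agent m k → ℂ) :
    F.errorFunctional a v = (∑ i, (starRingEnd ℂ) (a i) * F.followerError v i).re := rfl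

/-- The Lyapunov inequality for Filippov velocities. The hypothesis on `α₂` is that it dominates
the disturbance of every follower error by the leaders at time `t`. -/
theorem sum_sq_norm_drive_le_of_mem_filippovMap (hcol : F.NonCollocated) {α₂ t : ℝ}
    {pstar : Fin m → ℝ → ℂ}
    (hdist : ∀ (x : Agent m k → ℂ) i, ‖(F.Wff⁻¹ * F.Wfl).mulVec
      (fun j => leaderControl (pstar j) t (x (Sum.inl j))) i‖ ≤ α₂)
    {q v : Agent m k → ℂ} (hv : v ∈ filippovMap (F.closedLoop α₂ pstar) t q) :
    ∑ i, ‖F.drive q i‖ ^ 2 ≤ (∑ i, (starRingEnd ℂ) (F.drive q i) * F.followerError v i).re := by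
  have hcont := F.continuous_drive hcol
  -- This lower bound of the functional along the field is continuous in the position, although the
  -- field itself is not.
  let g : (Agent m k → ℂ) → ℝ := fun x => ∑ i, (((starRingEnd ℂ) (F.drive q i) * F.drive x i).re
    + α₂ * (‖F.drive x i‖ - ‖F.drive q i - F.drive x i‖) - α₂ * ‖F.drive q i‖)
  have hg : Continuous g := by
    have hi : ∀ i, Continuous fun x => F.drive x i := fun i => (continuous_apply i).comp hcont
    refine continuous_finsetSum _ fun i _ => ?_
    have h := hi i
    have h1 : Continuous fun x => ((starRingEnd ℂ) (F.drive q i) * F.drive x i).re :=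
      Complex.continuous_re.comp (continuous_const.mul h)
    exact (h1.add (continuous_const.mul (h.norm.sub (continuous_const.sub h).norm))).sub
      continuous_const
  have hgq : g q = ∑ i, ‖F.drive q i‖ ^ 2 := by
    refine Finset.sum_congr rfl fun i _ => ?_
    rw [Complex.conj_mul']
    norm_cast
    simp
  rw [← hgq, ← errorFunctional_apply]
  refine le_of_mem_filippovMap hv _ hg.continuousAt fun x => ?_
  rw [errorFunctional_apply, Complex.re_sum]
  refine Finset.sum_le_sum fun i _ => ?_
  have hd := hdist x i
  set d := (F.Wff⁻¹ * F.Wfl).mulVec (fun j => leaderControl (pstar j) t (x (Sum.inl j))) i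
  have hα : 0 ≤ α₂ := (norm_nonneg _).trans hd
  have herr : F.followerError (F.closedLoop α₂ pstar t x) i
      = F.drive x i + α₂ * normalise (F.drive x i) + d := rfl
  have h1 := mul_le_mul_of_nonneg_left
    (norm_sub_norm_sub_le_re_conj_mul_normalise (F.drive q i) (F.drive x i)) hα
  have h2 : -(α₂ * ‖F.drive q i‖) ≤ ((starRingEnd ℂ) (F.drive q i) * d).re := by
    refine le_trans (neg_le_neg ?_) (abs_le.1 (Complex.abs_re_le_norm _)).1
    rw [norm_mul, RCLike.norm_conj, mul_comm]
    gcongr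
  have h3 : (starRingEnd ℂ) (F.drive q i) * (F.drive x i + α₂ * normalise (F.drive x i) + d)
      = (starRingEnd ℂ) (F.drive q i) * F.drive x i
        + (α₂ : ℂ) * ((starRingEnd ℂ) (F.drive q i) * normalise (F.drive x i))
        + (starRingEnd ℂ) (F.drive q i) * d := by ring
  rw [herr, h3, Complex.add_re, Complex.add_re, Complex.re_ofReal_mul]
  linarith

/-- Invertibility of `W_ff` makes the drive control the constraint violations. -/
theorem exists_sum_sq_norm_Wf_mulVec_le (hloc : F.Localizable) (hcol : F.NonCollocated) :
    ∃ C : ℝ, 0 < C ∧ ∀ p, ∑ i, ‖F.Wf.mulVec p i‖ ^ 2 ≤ C * ∑ i, ‖F.drive p i‖ ^ 2 := by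
  obtain ⟨C, hC, h⟩ := exists_sum_sq_norm_mulVec_le F.Wff.conjTranspose⁻¹
  refine ⟨C, hC, fun p => ?_⟩
  have hdet : IsUnit F.Wff.conjTranspose.det := by
    rw [Matrix.det_conjTranspose]
    exact ((Matrix.isUnit_iff_isUnit_det _).1 hloc).star
  have hz : F.Wff.conjTranspose⁻¹.mulVec (F.drive p) = -F.Wf.mulVec p := by
    rw [F.drive_eq_neg_conjTranspose_mulVec hcol, Matrix.mulVec_neg, Matrix.mulVec_mulVec,
      Matrix.nonsing_inv_mul _ hdet, Matrix.one_mulVec]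
  simpa [hz] using h (F.drive p)

theorem lipschitzWith_Wf_mulVec_apply (i : Fin k) :
    ∃ K, LipschitzWith K fun p : Agent m k → ℂ => F.Wf.mulVec p i := by
  let L : (Agent m k → ℂ) →L[ℂ] ℂ :=
    LinearMap.toContinuousLinearMap ((LinearMap.proj i).comp F.Wf.mulVecLin)
  exact ⟨_, L.lipschitz⟩

/-- The Lyapunov function decays exponentially along Filippov solutions. -/
theorem exists_exp_decay (hloc : F.Localizable) (hcol : F.NonCollocated)
    {α₂ : ℝ} {pstar : Fin m → ℝ → ℂ}
    (hdist : ∀ t, 0 ≤ t → ∀ (x : Agent m k → ℂ) i, ‖(F.Wff⁻¹ * F.Wfl).mulVec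
      (fun j => leaderControl (pstar j) t (x (Sum.inl j))) i‖ ≤ α₂)
    {p : ℝ → Agent m k → ℂ}
    (hp : ∀ T : ℝ, 0 < T → IsFilippovSolutionOn (F.closedLoop α₂ pstar) p 0 T) :
    ∃ c : ℝ, 0 < c ∧ ∀ T, 0 < T → ∑ i, ‖F.Wf.mulVec (p T) i‖ ^ 2
      ≤ Real.exp (-c * T) * ∑ i, ‖F.Wf.mulVec (p 0) i‖ ^ 2 := by
  obtain ⟨C, hC, hle⟩ := F.exists_sum_sq_norm_Wf_mulVec_le hloc hcol
  refine ⟨2 / C, by positivity, fun T hT => ?_⟩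
  obtain ⟨hac, hder⟩ := hp T hT
  refine le_exp_mul_of_ae_deriv_le (V := fun t => ∑ i, ‖F.Wf.mulVec (p t) i‖ ^ 2) hT.le ?_ ?_
  · refine AbsolutelyContinuousOnInterval.finset_sum _ fun i _ => ?_
    obtain ⟨K, hK⟩ := F.lipschitzWith_Wf_mulVec_apply i
    have h := (hac.lipschitz_comp hK).lipschitz_comp lipschitzWith_one_norm
    simpa only [sq] using h.fun_mul h
  · filter_upwards [hder, ae_restrict_mem measurableSet_Icc] with t ⟨v, hv, hpv⟩ ht
    have hz : ∀ i, HasDerivAt (fun s => F.Wf.mulVec (p s) i) (F.Wf.mulVec v i) t := fun i =>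
      HasDerivAt.fun_sum (u := Finset.univ) fun l _ => (hasDerivAt_pi.1 hpv l).const_mul (F.Wf i l)
    refine ⟨_, HasDerivAt.fun_sum fun i _ => (hz i).norm_sq, ?_⟩
    have hinner : ∑ i, 2 * inner ℝ (F.Wf.mulVec (p t) i) (F.Wf.mulVec v i)
        = 2 * (∑ i, (starRingEnd ℂ) (F.Wf.mulVec (p t) i) * F.Wf.mulVec v i).re := by
      rw [← Finset.mul_sum, Complex.re_sum]
      simp only [Complex.inner, mul_comm]
    rw [hinner, F.sum_conj_Wf_mul_eq hloc hcol, Complex.neg_re]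
    have h1 := F.sum_sq_norm_drive_le_of_mem_filippovMap hcol (hdist t ht.1) hv
    have h2 : 2 / C * ∑ i, ‖F.Wf.mulVec (p t) i‖ ^ 2 ≤ 2 * ∑ i, ‖F.drive (p t) i‖ ^ 2 := by
      rw [div_mul_eq_mul_div, div_le_iff₀ hC]
      linarith [hle (p t)]
    linarith

end Nominal

end Formation

theorem mainTheorem1 {m k : ℕ} (F : Formation.Nominal m k)
    (hloc : F.Localizable) (hcol : F.NonCollocated) (hund : F.FollowersUndirected)
    (δ : ℝ) (pstar : Fin m → ℝ → ℂ)
    (hdiff : ∀ j, DifferentiableOn ℝ (pstar j) (Ici 0))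
    (hδ : ∀ j, ∀ t : ℝ, 0 ≤ t → ‖Formation.targetVel (pstar j) t‖ ≤ δ)
    (α₂ : ℝ) (hα : F.xi * (√2 + δ) * m ≤ α₂)
    (p : ℝ → Formation.Agent m k → ℂ)
    (hp : ∀ T : ℝ, 0 < T → Formation.IsFilippovSolutionOn (F.closedLoop α₂ pstar) p 0 T) :
    Tendsto (fun t => F.followerError (p t)) atTop (𝓝 0) := by
  obtain ⟨c, hc, hdecay⟩ := F.exists_exp_decay hloc hcol
    (fun t ht x => F.norm_mulVec_le_gain hα fun j =>
      Formation.norm_leaderControl_le (hδ j t ht) (x (Sum.inl j))) hp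
  have hexp : Tendsto (fun t => Real.exp (-c * t) * ∑ i, ‖F.Wf.mulVec (p 0) i‖ ^ 2) atTop
      (𝓝 0) := by
    have h : Tendsto (fun t => -c * t) atTop atBot :=
      tendsto_id.const_mul_atTop_of_neg (neg_neg_of_pos hc)
    simpa using (Real.tendsto_exp_atBot.comp h).mul_const _
  have hV : Tendsto (fun t => ∑ i, ‖F.Wf.mulVec (p t) i‖ ^ 2) atTop (𝓝 0) :=
    squeeze_zero' (Eventually.of_forall fun t => by positivity)
      ((eventually_gt_atTop 0).mono hdecay) hexp
  have hz : Tendsto (fun t => F.Wf.mulVec (p t)) atTop (𝓝 0) := by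
    refine tendsto_pi_nhds.2 fun i => squeeze_zero_norm (fun t => ?_)
      (by simpa using hV.sqrt)
    exact Real.le_sqrt_of_sq_le
      (Finset.single_le_sum (f := fun i => ‖F.Wf.mulVec (p t) i‖ ^ 2)
        (fun _ _ => by positivity) (Finset.mem_univ i))
  have hdet : IsUnit F.Wff.det := (Matrix.isUnit_iff_isUnit_det _).1 hloc
  have he : ∀ t, F.followerError (p t) = F.Wff⁻¹.mulVec (F.Wf.mulVec (p t)) := fun t => by
    rw [← F.Wff_mulVec_followerError hloc, Matrix.mulVec_mulVec, Matrix.nonsing_inv_mul _ hdet,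
      Matrix.one_mulVec]
  have hcont : Continuous fun z : Fin k → ℂ => F.Wff⁻¹.mulVec z := by fun_prop
  simp only [he]
  have h0 := hcont.tendsto 0
  rw [Matrix.mulVec_zero] at h0
  exact h0.comp hz
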